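/- For $a\in(0,1/2]$ and $r\in(0,1)$ put $r'=\sqrt{1-r^2}$, $$\mathcal K_a(r)=\frac{\pi}{2}\,{}_2F_1(a,1-a;1;r^2),\qquad \mu_a(r)=\frac{\pi}{2\sin(\pi a)}\,\frac{\mathcal K_a(r')}{\mathcal K_a(r)},\qquad m_a(r)=\frac{2}{\pi\sin(\pi a)}\,r'^2\,\mathcal K_a(r')\,\mathcal K_a(r),$$ where ${}_2F_1$ is the Gaussian hypergeometric function. The function $\mu_a$ is a strictly decreasing bijection from $(0,1)$ onto $(0,\infty)$; for $K>0$ let $\varphi_K^a(r)=\mu_a^{-1}(\mu_a(r)/K)$ be the generalized Hersch–Pfluger distortion function. Theorem. Let $\alpha,\beta,\gamma$ be real functions on $(0,1/2]\times(0,1)\times(0,1)$. Then for all $(a,r,t)\in(0,1/2]\times(0,1)\times(0,1)$: (1) the inequality $$\frac{\varphi_K^a(r)\,\varphi_K^a(t)}{\varphi_K^a(rt)}<e^{\alpha(a,r,t)\left(1-\frac1K\right)}$$ holds for all $K\in(1,\infty)$ if and only if $\alpha(a,r,t)\ge m_a(r)+m_a(t)-m_a(rt)$; (2) the inequalities $$e^{\gamma(a,r,t)(1-K)}<\frac{\varphi_{1/K}^a(r)\,\varphi_{1/K}^a(t)}{\varphi_{1/K}^a(rt)}<e^{\beta(a,r,t)(1-K)}$$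 hold for all $K\in(1,\infty)$ if and only if $\beta(a,r,t)\le m_a(r)+m_a(t)-m_a(rt)$ and $\gamma(a,r,t)\ge\mu_a(r)+\mu_a(t)-\mu_a(rt)$. In particular, each of these inequalities holds for all $(a,r,t)$ and all $K\in(1,\infty)$ if and only if the corresponding conditions on $\alpha$, respectively on $\beta$ and $\gamma$, hold for all $(a,r,t)$. -/

import Mathlib

/-- The generalized complete elliptic integral of the first kind,
`K_a(r) = (π / 2) F(a, 1 - a; 1; r ^ 2)`, for `0 < a < 1` and `0 ≤ r < 1`. -/
noncomputable def genEllipticK (a r : ℝ) : ℝ :=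
  Real.pi / 2 * ordinaryHypergeometric a (1 - a) (1 : ℝ) (r ^ 2)

/-- The complementary modulus `r' = √(1 - r ^ 2)`. -/
noncomputable def compModulus (r : ℝ) : ℝ :=
  Real.sqrt (1 - r ^ 2)

/-- The generalized Grötzsch ring function
`μ_a(r) = π / (2 sin (π a)) * K_a(r') / K_a(r)`. -/
noncomputable def genGrotzsch (a r : ℝ) : ℝ :=
  Real.pi / (2 * Real.sin (Real.pi * a)) *
    (genEllipticK a (compModulus r) / genEllipticK a r)

/-- The generalized Hersch–Pfluger distortion function
`φ_K^a(r) = μ_a⁻¹(μ_a(r) / K)`, where `μ_a⁻¹` is the inverse of `μ_a` on the interval `(0, 1)`. -/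
noncomputable def genHerschPfluger (a K r : ℝ) : ℝ :=
  Function.invFunOn (genGrotzsch a) (Set.Ioo 0 1) (genGrotzsch a r / K)

/-- The function `m_a(r) = 2 / (π sin (π a)) * r' ^ 2 * K_a(r') * K_a(r)`. -/
noncomputable def genHubnerM (a r : ℝ) : ℝ :=
  2 / (Real.pi * Real.sin (Real.pi * a)) * compModulus r ^ 2 *
    genEllipticK a (compModulus r) * genEllipticK a r

/-!
Write `F(x) = ₂F₁(a, 1 - a; 1; x)` and `x = r²`, so that `μ_a` is a multiple of `F(1 - x) / F(x)`.
Let `ℓ = -log ∘ μ_a⁻¹` on `(0, ∞)` and `A = μ_a(r)`, `B = μ_a(t)`, `C = μ_a(r t)`. Then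
`ℓ A + ℓ B = ℓ C`, and with `w = 1 / K` in the first part and `w = K` in the second the logarithm of
the quotient of distortion functions is `g w = ℓ (w C) - ℓ (w A) - ℓ (w B)`, which vanishes at `1`.

The Legendre relation (`legendre_relation`, with Gauss' value `tendsto_hypV_one` for the constant)
gives `ℓ' = h` with `h = (1 - x) F(x)²`, and `m_a = μ_a h`. Therefore `g'(1) = -M`, where
`M = m_a(r) + m_a(t) - m_a(r t)`, and since `h → 1` at infinity, `g' → -(A + B - C)`.
The theorem says that `g w` is strictly below the tangent `M (1 - w)` for all `w ≠ 1`, that it is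
strictly above `(A + B - C) (1 - w)` for `w > 1`, and that neither line can be improved. The last
point is clear from the derivatives. The second holds because `h < 1` is increasing and
`C ≤ A + B`, by superadditivity of the convex function `ℓ`.

The curve `g` is not concave in general, so the comparison with its tangent needs more
(`IsLogInverseModulus.lt_tangent`). In terms of `J v = (1 - w) v h(v) + ℓ (w v) - ℓ v`, it reads
`J C < J A + J B`. As `ℓ C = ℓ A + ℓ B`, it suffices that `J / ℓ` is strictly decreasing, and
this follows when the logarithmic slope `η = v h' / h` is strictly decreasing in `v`: the sign of
`(J / ℓ)'` is that of the difference between the tangent of `u ↦ θ ℓ u - u h u` at `v` and this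
function at `u = w v`, where `θ = v h(v) / ℓ v`, and the derivative `h u (θ - 1 - η u)` separates
the values to the left and to the right of `v`.

Finally, `η` is a positive multiple of `x F(1 - x) T(x)` with `T = F - 2 (1 - x) F'`. Here
`(1 - y) F(y)` is decreasing, and `T` has nonnegative Taylor coefficients because
`(1 - x) F' = a (1 - a) ∑ cₙ / (n + 1) xⁿ` with `a (1 - a) ≤ 1 / 4`; so `η` increases with `x`,
that is, decreases with `v = μ_a`.
-/

open Set Filter Topology

/-! ### Monotonicity and slopes -/

lemma strictMonoOn_of_hasDerivAt_pos {f f' : ℝ → ℝ} {D : Set ℝ} (hD : Convex ℝ D)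
    (hf : ∀ x ∈ D, HasDerivAt f (f' x) x) (hpos : ∀ x ∈ D, 0 < f' x) : StrictMonoOn f D :=
  strictMonoOn_of_hasDerivWithinAt_pos hD
    (fun x hx => (hf x hx).continuousAt.continuousWithinAt)
    (fun x hx => (hf x (interior_subset hx)).hasDerivWithinAt)
    (fun x hx => hpos x (interior_subset hx))

lemma strictAntiOn_of_hasDerivAt_neg {f f' : ℝ → ℝ} {D : Set ℝ} (hD : Convex ℝ D)
    (hf : ∀ x ∈ D, HasDerivAt f (f' x) x) (hneg : ∀ x ∈ D, f' x < 0) : StrictAntiOn f D :=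
  strictAntiOn_of_hasDerivWithinAt_neg hD
    (fun x hx => (hf x hx).continuousAt.continuousWithinAt)
    (fun x hx => (hf x (interior_subset hx)).hasDerivWithinAt)
    (fun x hx => hneg x (interior_subset hx))

/-- The values of a strictly increasing function with right limit `0` at `0` are positive. -/
lemma pos_of_strictMonoOn_of_tendsto_zero {f : ℝ → ℝ} {v : ℝ} (hv : 0 < v)
    (hf : StrictMonoOn f (Ioc 0 v)) (h0 : Tendsto f (𝓝[>] 0) (𝓝 0)) : 0 < f v := by
  have hmid : 0 ≤ f (v / 2) := by
    refine le_of_tendsto h0 ?_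
    filter_upwards [Ioo_mem_nhdsGT (half_pos hv)] with u hu
    exact (hf ⟨hu.1, by linarith [hu.2]⟩ ⟨by linarith, by linarith⟩ hu.2).le
  exact hmid.trans_lt (hf ⟨by linarith, by linarith⟩ ⟨hv, le_rfl⟩ (by linarith))

/-- If the derivative of `f` is below `s` to the left of `v` and above `s` to the right, then `f`
lies above its line of slope `s` through `(v, f v)`. -/
lemma lt_of_slope_separated {f f' : ℝ → ℝ} {s v u : ℝ} (hv : 0 < v) (hu : 0 < u)
    (huv : u ≠ v) (hf : ∀ y, 0 < y → HasDerivAt f (f' y) y)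
    (hl : ∀ y, 0 < y → y < v → f' y < s) (hr : ∀ y, v < y → s < f' y) :
    f v + s * (u - v) < f u := by
  have hc : ∀ p q : ℝ, 0 < p → ContinuousOn f (Icc p q) := fun p q hp y hy =>
    (hf y (hp.trans_le hy.1)).continuousAt.continuousWithinAt
  rcases huv.lt_or_gt with h | h
  · obtain ⟨y, hy, e⟩ := exists_hasDerivAt_eq_slope f f' h (hc u v hu)
      (fun y hy => hf y (hu.trans hy.1))
    have := hl y (hu.trans hy.1) hy.2
    rw [e, div_lt_iff₀ (sub_pos.2 h)] at this
    linarith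
  · obtain ⟨y, hy, e⟩ := exists_hasDerivAt_eq_slope f f' h (hc v u hv)
      (fun y hy => hf y (hv.trans hy.1))
    have := hr y hy.1
    rw [e, lt_div_iff₀ (sub_pos.2 h)] at this
    linarith

/-! ### Logarithms of inverse moduli -/

/-- A logarithmic inverse modulus: `ℓ` is a positive primitive of `h` on `(0, ∞)` that vanishes
at `0`, where `0 < h < 1` is strictly increasing with `h → 1` at infinity, and the logarithmic
slope `η v = v h'(v) / h v` is strictly decreasing. It is satisfied by `ℓ = -log ∘ μ_a⁻¹`. -/
structure IsLogInverseModulus (ℓ h η : ℝ → ℝ) : Prop where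
  pos : ∀ v, 0 < v → 0 < ℓ v
  hasDerivAt : ∀ v, 0 < v → HasDerivAt ℓ (h v) v
  tendsto_zero : Tendsto ℓ (𝓝[>] 0) (𝓝 0)
  slope_pos : ∀ v, 0 < v → 0 < h v
  slope_lt_one : ∀ v, 0 < v → h v < 1
  slope_strictMonoOn : StrictMonoOn h (Ioi 0)
  hasDerivAt_slope : ∀ v, 0 < v → HasDerivAt h (h v * η v / v) v
  tendsto_slope : Tendsto h atTop (𝓝 1)
  logSlope_strictAntiOn : StrictAntiOn η (Ioi 0)

namespace IsLogInverseModulus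

variable {ℓ h η : ℝ → ℝ}

lemma strictMonoOn (H : IsLogInverseModulus ℓ h η) : StrictMonoOn ℓ (Ioi 0) :=
  strictMonoOn_of_hasDerivAt_pos (convex_Ioi 0) H.hasDerivAt H.slope_pos

lemma tendsto_mul_slope (H : IsLogInverseModulus ℓ h η) :
    Tendsto (fun v => v * h v) (𝓝[>] 0) (𝓝 0) := by
  refine tendsto_of_tendsto_of_tendsto_of_le_of_le' tendsto_const_nhds
    (tendsto_nhdsWithin_of_tendsto_nhds tendsto_id) ?_ ?_
  · filter_upwards [self_mem_nhdsWithin] with v hv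
    exact (mul_pos hv (H.slope_pos v hv)).le
  · filter_upwards [self_mem_nhdsWithin] with v hv
    exact mul_le_of_le_one_right (le_of_lt hv) (H.slope_lt_one v hv).le

lemma hasDerivAt_mul_slope (H : IsLogInverseModulus ℓ h η) {v : ℝ} (hv : 0 < v) :
    HasDerivAt (fun u => u * h u) (h v * (1 + η v)) v := by
  refine ((hasDerivAt_id v).mul (H.hasDerivAt_slope v hv)).congr_deriv ?_
  simp only [id]
  field_simp

/-- `v h / ℓ` is strictly decreasing, in the form of the sign of its derivative. -/
lemma one_add_logSlope_mul_lt (H : IsLogInverseModulus ℓ h η) {v : ℝ} (hv : 0 < v) :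
    (1 + η v) * ℓ v < v * h v := by
  have hpos := pos_of_strictMonoOn_of_tendsto_zero
    (f := fun u => u * h u - (1 + η v) * ℓ u) hv ?_ ?_
  · simpa using hpos
  · have hd : ∀ u, 0 < u → HasDerivAt (fun u => u * h u - (1 + η v) * ℓ u)
        (h u * (1 + η u) - (1 + η v) * h u) u := fun u hu =>
      (H.hasDerivAt_mul_slope hu).sub ((H.hasDerivAt u hu).const_mul _)
    refine strictMonoOn_of_hasDerivWithinAt_pos
      (f' := fun u => h u * (1 + η u) - (1 + η v) * h u) (convex_Ioc 0 v)
      (fun u hu => (hd u hu.1).continuousAt.continuousWithinAt)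
      (fun u hu => (hd u (interior_subset hu).1).hasDerivWithinAt) (fun u hu => ?_)
    rw [interior_Ioc] at hu
    have h1 := H.logSlope_strictAntiOn (show u ∈ Ioi 0 from hu.1) (show v ∈ Ioi 0 from hv) hu.2
    nlinarith [mul_pos (H.slope_pos u hu.1) (sub_pos.2 h1)]
  · simpa using H.tendsto_mul_slope.sub (H.tendsto_zero.const_mul (1 + η v))

/-- For `θ = v h v / ℓ v`, the function `Ψ u = θ ℓ u - u h u`, which vanishes at `v`, lies strictly
above its tangent at `v`. Its derivative is `h u (θ - 1 - η u)`; the second factor is increasing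
and positive at `v`, so that the derivative crosses the value `Ψ' v` only at `v`. -/
lemma tangent_lt (H : IsLogInverseModulus ℓ h η) {u v : ℝ} (hu : 0 < u) (hv : 0 < v)
    (huv : u ≠ v) :
    h v * (v * h v / ℓ v - 1 - η v) * (u - v) < v * h v / ℓ v * ℓ u - u * h u := by
  set θ := v * h v / ℓ v with hθ
  have hθv : 0 < θ - 1 - η v := by
    have := (lt_div_iff₀ (H.pos v hv)).2 (H.one_add_logSlope_mul_lt hv)
    rw [← hθ] at this
    linarith
  have key := lt_of_slope_separated (f := fun y => θ * ℓ y - y * h y)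
    (f' := fun y => h y * (θ - 1 - η y)) (s := h v * (θ - 1 - η v)) hv hu huv ?_ ?_ ?_
  · have h0 : θ * ℓ v - v * h v = 0 := by
      rw [hθ, div_mul_cancel₀ _ (H.pos v hv).ne', sub_self]
    simpa [h0] using key
  · intro y hy
    exact (((H.hasDerivAt y hy).const_mul θ).sub (H.hasDerivAt_mul_slope hy)).congr_deriv (by ring)
  · intro y hy hyv
    have h1 := H.logSlope_strictAntiOn (show y ∈ Ioi 0 from hy) (show v ∈ Ioi 0 from hv) hyv
    have h2 := H.slope_strictMonoOn (show y ∈ Ioi 0 from hy) (show v ∈ Ioi 0 from hv) hyv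
    have h3 := H.slope_pos y hy
    calc h y * (θ - 1 - η y) < h y * (θ - 1 - η v) := by gcongr
      _ < h v * (θ - 1 - η v) := by gcongr
  · intro y hvy
    have hy := hv.trans hvy
    have h1 := H.logSlope_strictAntiOn (show v ∈ Ioi 0 from hv) (show y ∈ Ioi 0 from hy) hvy
    have h2 := H.slope_strictMonoOn (show v ∈ Ioi 0 from hv) (show y ∈ Ioi 0 from hy) hvy
    have h3 := H.slope_pos y hy
    calc h v * (θ - 1 - η v) < h y * (θ - 1 - η v) := by gcongr
      _ < h y * (θ - 1 - η y) := by gcongr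

/-- The deviation of `ℓ` from its tangent at `v`, evaluated at `w v`, relative to `ℓ v`, is
strictly decreasing in `v`. -/
lemma deviation_div_strictAntiOn (H : IsLogInverseModulus ℓ h η) {w : ℝ} (hw : 0 < w)
    (hw1 : w ≠ 1) :
    StrictAntiOn (fun v => ((1 - w) * (v * h v) + ℓ (w * v) - ℓ v) / ℓ v) (Ioi 0) := by
  have hd : ∀ v, 0 < v → HasDerivAt
      (fun v => ((1 - w) * (v * h v) + ℓ (w * v) - ℓ v) / ℓ v)
      ((((1 - w) * (h v * (1 + η v)) + h (w * v) * w - h v) * ℓ v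
        - ((1 - w) * (v * h v) + ℓ (w * v) - ℓ v) * h v) / ℓ v ^ 2) v := by
    intro v hv
    have h1 : HasDerivAt (fun v => ℓ (w * v)) (h (w * v) * w) v := by
      have h2 := (hasDerivAt_id v).const_mul w
      rw [mul_one] at h2
      exact (H.hasDerivAt (w * v) (mul_pos hw hv)).comp v h2
    exact ((((H.hasDerivAt_mul_slope hv).const_mul (1 - w)).add h1).sub
      (H.hasDerivAt v hv)).div (H.hasDerivAt v hv) (H.pos v hv).ne'
  refine strictAntiOn_of_hasDerivAt_neg (convex_Ioi 0) hd (fun v hv => ?_)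
  rw [mem_Ioi] at hv
  have hl := H.pos v hv
  have hne : w * v ≠ v := fun e => hw1 (mul_right_cancel₀ hv.ne' (e.trans (one_mul v).symm))
  have ht := H.tangent_lt (mul_pos hw hv) hv hne
  refine div_neg_of_neg_of_pos ?_ (by positivity)
  have e : ((1 - w) * (h v * (1 + η v)) + h (w * v) * w - h v) * ℓ v
      - ((1 - w) * (v * h v) + ℓ (w * v) - ℓ v) * h v
      = -(ℓ v / v) * (v * h v / ℓ v * ℓ (w * v) - w * v * h (w * v)
        - h v * (v * h v / ℓ v - 1 - η v) * (w * v - v)) := by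
    field_simp
    ring
  rw [e]
  exact mul_neg_of_neg_of_pos (neg_neg_of_pos (div_pos hl hv)) (sub_pos.2 ht)

variable {A B C : ℝ}

lemma lt_of_add_eq (H : IsLogInverseModulus ℓ h η) (hA : 0 < A) (hB : 0 < B) (hC : 0 < C)
    (hABC : ℓ A + ℓ B = ℓ C) : A < C := by
  refine (H.strictMonoOn.lt_iff_lt (show A ∈ Ioi 0 from hA) (show C ∈ Ioi 0 from hC)).1 ?_
  linarith [H.pos B hB]

/-- The curve `w ↦ ℓ (C w) - ℓ (A w) - ℓ (B w)`, which vanishes at `1`, lies strictly below its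
tangent at `1`. -/
lemma lt_tangent (H : IsLogInverseModulus ℓ h η) (hA : 0 < A) (hB : 0 < B) (hC : 0 < C)
    (hABC : ℓ A + ℓ B = ℓ C) {w : ℝ} (hw : 0 < w) (hw1 : w ≠ 1) :
    ℓ (w * C) - ℓ (w * A) - ℓ (w * B) < (A * h A + B * h B - C * h C) * (1 - w) := by
  have hAC := H.deviation_div_strictAntiOn hw hw1 (show A ∈ Ioi 0 from hA)
    (show C ∈ Ioi 0 from hC) (H.lt_of_add_eq hA hB hC hABC)
  have hBC := H.deviation_div_strictAntiOn hw hw1 (show B ∈ Ioi 0 from hB)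
    (show C ∈ Ioi 0 from hC) (H.lt_of_add_eq hB hA hC (by linarith))
  simp only at hAC hBC
  have hq := div_mul_cancel₀ ((1 - w) * (C * h C) + ℓ (w * C) - ℓ C) (H.pos C hC).ne'
  set q := ((1 - w) * (C * h C) + ℓ (w * C) - ℓ C) / ℓ C
  rw [lt_div_iff₀ (H.pos A hA)] at hAC
  rw [lt_div_iff₀ (H.pos B hB)] at hBC
  have : q * ℓ C = q * ℓ A + q * ℓ B := by rw [← hABC]; ring
  linarith

/-- `ℓ` is convex and vanishes at `0`, so that it is superadditive. -/
lemma le_add (H : IsLogInverseModulus ℓ h η) (hA : 0 < A) (hB : 0 < B) (hC : 0 < C)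
    (hABC : ℓ A + ℓ B = ℓ C) : C ≤ A + B := by
  by_contra! hlt
  have hmono : StrictMonoOn (fun u => ℓ (u + B) - ℓ u) (Ioc 0 A) := by
    have hd : ∀ u, 0 < u → HasDerivAt (fun u => ℓ (u + B) - ℓ u) (h (u + B) - h u) u :=
      fun u hu =>
        ((H.hasDerivAt (u + B) (by positivity)).comp_add_const u B).sub (H.hasDerivAt u hu)
    refine strictMonoOn_of_hasDerivAt_pos (convex_Ioc 0 A) (fun u hu => hd u hu.1)
      (fun u hu => ?_)
    exact sub_pos.2 (H.slope_strictMonoOn hu.1 (show u + B ∈ Ioi 0 from add_pos hu.1 hB)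
      (by linarith))
  have hlim : Tendsto (fun u => ℓ (u + B) - ℓ u - ℓ B) (𝓝[>] 0) (𝓝 0) := by
    have h1 : Tendsto (fun u => ℓ (u + B)) (𝓝[>] 0) (𝓝 (ℓ B)) := by
      have h2 : Tendsto (fun u : ℝ => u + B) (𝓝[>] 0) (𝓝 B) := by
        have : Tendsto (fun u : ℝ => u + B) (𝓝 0) (𝓝 (0 + B)) := tendsto_id.add_const B
        rw [zero_add] at this
        exact this.mono_left nhdsWithin_le_nhds
      exact (H.hasDerivAt B hB).continuousAt.tendsto.comp h2
    simpa using (h1.sub H.tendsto_zero).sub_const (ℓ B)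
  have hpos := pos_of_strictMonoOn_of_tendsto_zero (f := fun u => ℓ (u + B) - ℓ u - ℓ B) hA
    (fun x hx y hy hxy => sub_lt_sub_right (hmono hx hy hxy) _) hlim
  have h3 := H.strictMonoOn (show A + B ∈ Ioi 0 from add_pos hA hB) (show C ∈ Ioi 0 from hC) hlt
  linarith

lemma hasDerivAt_scaled (H : IsLogInverseModulus ℓ h η) (hA : 0 < A) (hB : 0 < B) (hC : 0 < C)
    {w : ℝ} (hw : 0 < w) :
    HasDerivAt (fun w => ℓ (w * C) - ℓ (w * A) - ℓ (w * B))
      (C * h (w * C) - A * h (w * A) - B * h (w * B)) w := by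
  have hd : ∀ D : ℝ, 0 < D → HasDerivAt (fun w => ℓ (w * D)) (D * h (w * D)) w := by
    intro D hD
    have h1 := (H.hasDerivAt (w * D) (mul_pos hw hD)).comp w ((hasDerivAt_id w).mul_const D)
    exact h1.congr_deriv (by ring)
  exact ((hd C hC).sub (hd A hA)).sub (hd B hB)

/-- Beyond `w = 1` the curve lies strictly above the line through `(1, 0)` with its slope at
infinity. -/
lemma asymptote_lt (H : IsLogInverseModulus ℓ h η) (hA : 0 < A) (hB : 0 < B) (hC : 0 < C)
    (hABC : ℓ A + ℓ B = ℓ C) {w : ℝ} (hw1 : 1 < w) :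
    (A + B - C) * (1 - w) < ℓ (w * C) - ℓ (w * A) - ℓ (w * B) := by
  obtain ⟨y, hy, e⟩ := exists_hasDerivAt_eq_slope (fun w => ℓ (w * C) - ℓ (w * A) - ℓ (w * B))
    (fun w => C * h (w * C) - A * h (w * A) - B * h (w * B)) hw1
    (fun y hy => (H.hasDerivAt_scaled hA hB hC
      (by linarith [hy.1])).continuousAt.continuousWithinAt)
    (fun y hy => H.hasDerivAt_scaled hA hB hC (by linarith [hy.1]))
  have hy0 : 0 < y := by linarith [hy.1]
  have h1 := H.slope_strictMonoOn (mul_pos hy0 hA) (mul_pos hy0 hC)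
    (mul_lt_mul_of_pos_left (H.lt_of_add_eq hA hB hC hABC) hy0)
  have h2 := H.slope_strictMonoOn (mul_pos hy0 hB) (mul_pos hy0 hC)
    (mul_lt_mul_of_pos_left (H.lt_of_add_eq hB hA hC (by linarith)) hy0)
  have h3 := H.slope_lt_one _ (mul_pos hy0 hC)
  have h4 := H.le_add hA hB hC hABC
  have h5 : -(A + B - C) < C * h (y * C) - A * h (y * A) - B * h (y * B) := by
    nlinarith [mul_pos hA (sub_pos.2 h1), mul_pos hB (sub_pos.2 h2),
      mul_nonneg (sub_nonneg.2 h4) (sub_pos.2 h3).le]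
  rw [e, lt_div_iff₀ (by linarith)] at h5
  simp only [one_mul] at h5
  linarith

/-- If `α (1 - w)` dominates the curve to the left of `1`, then its slope `-α` at `1` is at most
that of the curve. -/
lemma tangent_le_of_left (H : IsLogInverseModulus ℓ h η) (hA : 0 < A) (hB : 0 < B) (hC : 0 < C)
    (hABC : ℓ A + ℓ B = ℓ C) {α : ℝ}
    (hα : ∀ w, 0 < w → w < 1 → ℓ (w * C) - ℓ (w * A) - ℓ (w * B) < α * (1 - w)) :
    A * h A + B * h B - C * h C ≤ α := by
  have hd := (H.hasDerivAt_scaled hA hB hC one_pos).hasDerivWithinAt (s := Iio 1)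
  rw [hasDerivWithinAt_iff_tendsto_slope' (by simp)] at hd
  have h1 : -α ≤ C * h (1 * C) - A * h (1 * A) - B * h (1 * B) := by
    refine ge_of_tendsto hd ?_
    filter_upwards [Ioo_mem_nhdsLT (zero_lt_one' ℝ)] with w hw
    have h2 := hα w hw.1 hw.2
    rw [slope_def_field, le_div_iff_of_neg (by linarith [hw.2])]
    simp only [one_mul]
    linarith
  simp only [one_mul] at h1
  linarith

/-- If `β (1 - w)` dominates the curve to the right of `1`, then its slope `-β` at `1` is at least
that of the curve. -/
lemma le_tangent_of_right (H : IsLogInverseModulus ℓ h η) (hA : 0 < A) (hB : 0 < B) (hC : 0 < C)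
    (hABC : ℓ A + ℓ B = ℓ C) {β : ℝ}
    (hβ : ∀ w, 1 < w → ℓ (w * C) - ℓ (w * A) - ℓ (w * B) < β * (1 - w)) :
    β ≤ A * h A + B * h B - C * h C := by
  have hd := (H.hasDerivAt_scaled hA hB hC one_pos).hasDerivWithinAt (s := Ioi 1)
  rw [hasDerivWithinAt_iff_tendsto_slope' (by simp)] at hd
  have h1 : C * h (1 * C) - A * h (1 * A) - B * h (1 * B) ≤ -β := by
    refine le_of_tendsto hd ?_
    filter_upwards [self_mem_nhdsWithin] with w hw
    have hw : 1 < w := hw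
    have h2 := hβ w hw
    rw [slope_def_field, div_le_iff₀ (by linarith)]
    simp only [one_mul]
    linarith
  simp only [one_mul] at h1
  linarith

/-- If `γ (1 - w)` stays below the curve on `(1, ∞)`, then its slope `-γ` is at most the limit
`C - A - B` of the slope of the curve. -/
lemma asymptote_le (H : IsLogInverseModulus ℓ h η) (hA : 0 < A) (hB : 0 < B) (hC : 0 < C)
    {γ : ℝ} (hγ : ∀ w, 1 < w → γ * (1 - w) < ℓ (w * C) - ℓ (w * A) - ℓ (w * B)) :
    A + B - C ≤ γ := by
  by_contra! hlt
  obtain ⟨κ, hκ1, hκ2⟩ := exists_between hlt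
  have hs : ∀ D : ℝ, 0 < D → Tendsto (fun w => D * h (w * D)) atTop (𝓝 (D * 1)) := fun D hD =>
    (H.tendsto_slope.comp (tendsto_id.atTop_mul_const hD)).const_mul D
  have hlim := ((hs C hC).sub (hs A hA)).sub (hs B hB)
  have hev := hlim.eventually_lt_const (show C * 1 - A * 1 - B * 1 < -κ by linarith)
  obtain ⟨w₀, hw₀⟩ := eventually_atTop.1 (hev.and (eventually_gt_atTop 1))
  have h1 := (hw₀ w₀ le_rfl).2
  set g := fun w => ℓ (w * C) - ℓ (w * A) - ℓ (w * B) with hg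
  -- far out the slope is below `-κ`, which is below the slope `-γ` of the line
  have hle : ∀ w, w₀ < w → g w ≤ g w₀ - κ * (w - w₀) := by
    intro w hw
    obtain ⟨y, hy, e⟩ := exists_hasDerivAt_eq_slope g
      (fun w => C * h (w * C) - A * h (w * A) - B * h (w * B)) hw
      (fun y hy => (H.hasDerivAt_scaled hA hB hC
        (by linarith [hy.1])).continuousAt.continuousWithinAt)
      (fun y hy => H.hasDerivAt_scaled hA hB hC (by linarith [hy.1]))
    have h2 := (hw₀ y hy.1.le).1
    rw [e, div_lt_iff₀ (by linarith)] at h2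
    linarith
  obtain ⟨w, hw, hw'⟩ := ((eventually_gt_atTop w₀).and
    (eventually_gt_atTop ((g w₀ + κ * w₀ - γ) / (κ - γ)))).exists
  rw [div_lt_iff₀ (by linarith)] at hw'
  have h3 := hle w hw
  have h4 := hγ w (h1.trans hw)
  change γ * (1 - w) < g w at h4
  linarith

end IsLogInverseModulus

/-! ### The hypergeometric series `₂F₁(a, 1 - a; 1; x)` -/

/-- A real power series with coefficients bounded by `1` can be differentiated term by term in the
open unit interval. -/
lemma hasDerivAt_tsum_mul_pow {c : ℕ → ℝ} (hc : ∀ n, |c n| ≤ 1) {x : ℝ} (hx : |x| < 1) :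
    HasDerivAt (fun y => ∑' n, c n * y ^ n) (∑' n : ℕ, c n * (n * x ^ (n - 1))) x := by
  obtain ⟨ρ, hxρ, hρ1⟩ := exists_between hx
  have hρ0 : 0 < ρ := (abs_nonneg x).trans_lt hxρ
  have hu : Summable fun n : ℕ => (n : ℝ) * ρ ^ (n - 1) := by
    have h1 := (summable_pow_mul_geometric_of_norm_lt_one (R := ℝ) 1
      (show ‖ρ‖ < 1 by rwa [Real.norm_eq_abs, abs_of_pos hρ0])).div_const ρ
    refine h1.congr fun n => ?_
    cases n with
    | zero => simp
    | succ n =>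
      rw [Nat.add_sub_cancel, pow_one, pow_succ]
      field_simp
  refine hasDerivAt_tsum_of_isPreconnected (t := Metric.ball 0 ρ) (y₀ := 0) hu Metric.isOpen_ball
    (convex_ball 0 ρ).isPreconnected (fun n y _ => (hasDerivAt_pow n y).const_mul (c n))
    (fun n y hy => ?_) (Metric.mem_ball_self hρ0) ?_ (by simpa using hxρ)
  · rw [mem_ball_zero_iff, Real.norm_eq_abs] at hy
    rw [Real.norm_eq_abs, abs_mul, abs_mul, abs_pow, Nat.abs_cast]
    calc |c n| * (n * |y| ^ (n - 1)) ≤ 1 * (n * ρ ^ (n - 1)) := by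
          gcongr
          exact hc n
      _ = _ := one_mul _
  · refine summable_of_ne_finset_zero (s := {0}) fun n hn => ?_
    simp only [Finset.mem_singleton] at hn
    simp [hn]

lemma summable_mul_pow {c : ℕ → ℝ} (hc : ∀ n, |c n| ≤ 1) {x : ℝ} (hx : |x| < 1) :
    Summable fun n => c n * x ^ n := by
  refine Summable.of_norm_bounded (summable_geometric_of_lt_one (abs_nonneg x) hx) fun n => ?_
  rw [Real.norm_eq_abs, abs_mul, abs_pow]
  exact mul_le_of_le_one_left (by positivity) (hc n)

/-- The coefficient `(a)_n (1 - a)_n / (n!)²` of `₂F₁(a, 1 - a; 1; ·)`. -/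
noncomputable def hypCoeff (a : ℝ) (n : ℕ) : ℝ :=
  ∏ j ∈ Finset.range n, (a + j) * (1 - a + j) / ((j : ℝ) + 1) ^ 2

/-- The series `₂F₁(a, 1 - a; 1; x) = ∑ cₙ xⁿ`. -/
noncomputable def hypF (a x : ℝ) : ℝ := ∑' n, hypCoeff a n * x ^ n

/-- The series `₂F₁(a, 1 - a; 2; x) = ∑ cₙ / (n + 1) xⁿ`. -/
noncomputable def hypV (a x : ℝ) : ℝ := ∑' n, hypCoeff a n / (n + 1) * x ^ n

/-- The combination `F - 2 a (1 - a) V`, equal to `F - 2 (1 - x) F'`. -/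
noncomputable def hypT (a x : ℝ) : ℝ := hypF a x - 2 * (a * (1 - a)) * hypV a x

lemma ordinaryHypergeometric_eq_hypF (a x : ℝ) :
    ordinaryHypergeometric a (1 - a) (1 : ℝ) x = hypF a x := by
  rw [ordinaryHypergeometric_eq_tsum, hypF]
  refine tsum_congr fun n => ?_
  rw [smul_eq_mul]
  congr 1
  induction n with
  | zero => simp [hypCoeff]
  | succ n ih =>
    rw [hypCoeff, Finset.prod_range_succ, ← hypCoeff, ← ih]
    simp only [ascPochhammer_succ_eval, ascPochhammer_eval_one, Nat.factorial_succ]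
    have := Nat.cast_ne_zero (R := ℝ).2 n.factorial_ne_zero
    push_cast
    field_simp
    ring

section

variable {a : ℝ}

lemma hypCoeff_zero : hypCoeff a 0 = 1 := by simp [hypCoeff]

lemma hypCoeff_succ (n : ℕ) :
    (n + 1 : ℝ) * hypCoeff a (n + 1) = hypCoeff a n * ((a * (1 - a) + n * (n + 1)) / (n + 1)) := by
  rw [hypCoeff, Finset.prod_range_succ, ← hypCoeff]
  field_simp
  ring

lemma param_pos (ha : a ∈ Ioo (0 : ℝ) 1) : 0 < a * (1 - a) := mul_pos ha.1 (by linarith [ha.2])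

lemma param_le (a : ℝ) : a * (1 - a) ≤ 1 / 4 := by nlinarith [sq_nonneg (a - 1 / 2)]

lemma hypCoeff_pos (ha : a ∈ Ioo (0 : ℝ) 1) (n : ℕ) : 0 < hypCoeff a n := by
  refine Finset.prod_pos fun j _ => ?_
  have h1 := ha.1
  have h2 : 0 < 1 - a := by linarith [ha.2]
  positivity

lemma hypCoeff_le_one (ha : a ∈ Ioo (0 : ℝ) 1) (n : ℕ) : hypCoeff a n ≤ 1 := by
  have h1 := ha.1
  have h2 : 0 < 1 - a := by linarith [ha.2]
  refine Finset.prod_le_one (fun j _ => by positivity) fun j _ => ?_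
  rw [div_le_one (by positivity)]
  have hj : (0 : ℝ) ≤ j := j.cast_nonneg
  nlinarith [param_le a]

lemma abs_hypCoeff_le (ha : a ∈ Ioo (0 : ℝ) 1) (n : ℕ) : |hypCoeff a n| ≤ 1 := by
  rw [abs_of_pos (hypCoeff_pos ha n)]
  exact hypCoeff_le_one ha n

lemma hypCoeff_div_le (ha : a ∈ Ioo (0 : ℝ) 1) (n : ℕ) :
    hypCoeff a n / (n + 1) ≤ hypCoeff a n :=
  div_le_self (hypCoeff_pos ha n).le (by linarith [n.cast_nonneg (α := ℝ)])

lemma abs_hypCoeff_div_le (ha : a ∈ Ioo (0 : ℝ) 1) (n : ℕ) : |hypCoeff a n / (n + 1)| ≤ 1 := by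
  rw [abs_of_pos (div_pos (hypCoeff_pos ha n) (by positivity))]
  exact (hypCoeff_div_le ha n).trans (hypCoeff_le_one ha n)

lemma summable_hypF (ha : a ∈ Ioo (0 : ℝ) 1) {x : ℝ} (hx : |x| < 1) :
    Summable fun n => hypCoeff a n * x ^ n := summable_mul_pow (abs_hypCoeff_le ha) hx

lemma summable_hypV (ha : a ∈ Ioo (0 : ℝ) 1) {x : ℝ} (hx : |x| < 1) :
    Summable fun n : ℕ => hypCoeff a n / (n + 1) * x ^ n :=
  summable_mul_pow (abs_hypCoeff_div_le ha) hx

lemma hypF_zero : hypF a 0 = 1 := by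
  rw [hypF, tsum_eq_single 0 (fun n hn => by simp [hn])]
  simp [hypCoeff_zero]

/-- `(1 - x) F' = a (1 - a) V`, from the recursion of the coefficients. -/
lemma hasDerivAt_hypF (ha : a ∈ Ioo (0 : ℝ) 1) {x : ℝ} (hx : |x| < 1) :
    HasDerivAt (hypF a) (a * (1 - a) * hypV a x / (1 - x)) x := by
  have h := hasDerivAt_tsum_mul_pow (abs_hypCoeff_le ha) hx
  refine h.congr_deriv ?_
  have hx1 : 0 < 1 - x := by linarith [le_abs_self x]
  have hs : Summable fun n : ℕ => hypCoeff a n * (n * x ^ n) := by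
    refine Summable.of_norm_bounded ((summable_pow_mul_geometric_of_norm_lt_one (R := ℝ) 1
      (show ‖|x|‖ < 1 by rwa [Real.norm_eq_abs, abs_abs]))) fun n => ?_
    rw [Real.norm_eq_abs, abs_mul, abs_mul, abs_pow, Nat.abs_cast, pow_one]
    exact mul_le_of_le_one_left (by positivity) (abs_hypCoeff_le ha n)
  have e : ∀ n : ℕ, hypCoeff a (n + 1) * (((n + 1 : ℕ) : ℝ) * x ^ (n + 1 - 1))
      = a * (1 - a) * (hypCoeff a n / (n + 1) * x ^ n) + hypCoeff a n * (n * x ^ n) := by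
    intro n
    have := hypCoeff_succ (a := a) n
    rw [Nat.add_sub_cancel, ← mul_assoc, mul_comm (hypCoeff a (n + 1))]
    push_cast
    rw [this]
    field_simp
  have hs1 : Summable fun n : ℕ => hypCoeff a n * (n * x ^ (n - 1)) := by
    refine (summable_nat_add_iff 1).1 ?_
    exact (((summable_hypV ha hx).mul_left (a * (1 - a))).add hs).congr fun n => (e n).symm
  have h1 : ∑' n : ℕ, hypCoeff a n * (n * x ^ (n - 1))
      = a * (1 - a) * hypV a x + ∑' n : ℕ, hypCoeff a n * (n * x ^ n) := by
    rw [hs1.tsum_eq_zero_add, tsum_congr e,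
      ((summable_hypV ha hx).mul_left (a * (1 - a))).tsum_add hs, tsum_mul_left, hypV]
    simp
  have h2 : ∑' n : ℕ, hypCoeff a n * (n * x ^ n)
      = x * ∑' n : ℕ, hypCoeff a n * (n * x ^ (n - 1)) := by
    rw [← tsum_mul_left]
    refine tsum_congr fun n => ?_
    cases n with
    | zero => simp
    | succ n =>
      rw [Nat.add_sub_cancel, pow_succ]
      ring
  rw [eq_div_iff hx1.ne']
  rw [h2] at h1
  linarith

lemma continuousAt_hypV (ha : a ∈ Ioo (0 : ℝ) 1) {x : ℝ} (hx : |x| < 1) :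
    ContinuousAt (hypV a) x := (hasDerivAt_tsum_mul_pow (abs_hypCoeff_div_le ha) hx).continuousAt

/-- `(x V)' = F`. -/
lemma hasDerivAt_hypV (ha : a ∈ Ioo (0 : ℝ) 1) {x : ℝ} (hx : |x| < 1) (hx0 : x ≠ 0) :
    HasDerivAt (hypV a) ((hypF a x - hypV a x) / x) x := by
  have h := hasDerivAt_tsum_mul_pow (abs_hypCoeff_div_le ha) hx
  refine h.congr_deriv ?_
  rw [eq_div_iff hx0, hypF, hypV, ← (summable_hypF ha hx).tsum_sub (summable_hypV ha hx),
    ← tsum_mul_right]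
  refine tsum_congr fun n => ?_
  cases n with
  | zero => simp
  | succ n =>
    rw [Nat.add_sub_cancel, pow_succ]
    field_simp
    ring

lemma one_le_hypV (ha : a ∈ Ioo (0 : ℝ) 1) {x : ℝ} (hx : x ∈ Ico (0 : ℝ) 1) : 1 ≤ hypV a x := by
  have h := (summable_hypV ha (x := x) (by rw [abs_of_nonneg hx.1]; exact hx.2)).le_tsum 0
    fun n _ => mul_nonneg (div_pos (hypCoeff_pos ha n) (by positivity)).le (pow_nonneg hx.1 n)
  rw [hypV]
  simpa [hypCoeff_zero] using h

lemma hypV_le_hypF (ha : a ∈ Ioo (0 : ℝ) 1) {x : ℝ} (hx : x ∈ Ico (0 : ℝ) 1) :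
    hypV a x ≤ hypF a x := by
  have hx' : |x| < 1 := by rw [abs_of_nonneg hx.1]; exact hx.2
  exact (summable_hypV ha hx').tsum_le_tsum
    (fun n => mul_le_mul_of_nonneg_right (hypCoeff_div_le ha n) (pow_nonneg hx.1 n))
    (summable_hypF ha hx')

lemma hypF_pos (ha : a ∈ Ioo (0 : ℝ) 1) {x : ℝ} (hx : x ∈ Ico (0 : ℝ) 1) : 0 < hypF a x := by
  linarith [one_le_hypV ha hx, hypV_le_hypF ha hx]

lemma hypT_pos (ha : a ∈ Ioo (0 : ℝ) 1) {x : ℝ} (hx : x ∈ Ico (0 : ℝ) 1) : 0 < hypT a x := by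
  have h1 := one_le_hypV ha hx
  have h2 := hypV_le_hypF ha hx
  have h3 := param_le a
  rw [hypT]
  nlinarith

/-- The coefficients of `T` are nonnegative. -/
lemma monotoneOn_hypT (ha : a ∈ Ioo (0 : ℝ) 1) : MonotoneOn (hypT a) (Ico 0 1) := by
  have habs : ∀ x ∈ Ico (0 : ℝ) 1, |x| < 1 := fun x hx => by rw [abs_of_nonneg hx.1]; exact hx.2
  have hT : ∀ x ∈ Ico (0 : ℝ) 1, HasSum (fun n : ℕ => hypCoeff a n * x ^ n
      - 2 * (a * (1 - a)) * (hypCoeff a n / (n + 1) * x ^ n)) (hypT a x) := fun x hx =>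
    (summable_hypF ha (habs x hx)).hasSum.sub ((summable_hypV ha (habs x hx)).hasSum.mul_left _)
  intro x hx y hy hxy
  refine hasSum_le (fun n => ?_) (hT x hx) (hT y hy)
  have e : ∀ z : ℝ, hypCoeff a n * z ^ n - 2 * (a * (1 - a)) * (hypCoeff a n / (n + 1) * z ^ n)
      = (hypCoeff a n - 2 * (a * (1 - a)) * (hypCoeff a n / (n + 1))) * z ^ n := fun z => by ring
  rw [e, e]
  refine mul_le_mul_of_nonneg_left (pow_le_pow_left₀ hx.1 hxy n) ?_
  have h1 := hypCoeff_div_le ha n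
  have h2 := hypCoeff_pos ha n
  have h3 : 0 < hypCoeff a n / (n + 1) := by positivity
  nlinarith [param_le a]

lemma sin_pi_mul_pos (ha : a ∈ Ioo (0 : ℝ) 1) : 0 < Real.sin (Real.pi * a) := by
  refine Real.sin_pos_of_pos_of_lt_pi (mul_pos Real.pi_pos ha.1) ?_
  nlinarith [Real.pi_pos, ha.2]

/-- `n cₙ → sin (π a) / π`, by Euler's limit formula and the reflection formula. -/
lemma tendsto_mul_hypCoeff (ha : a ∈ Ioo (0 : ℝ) 1) :
    Tendsto (fun n : ℕ => (n : ℝ) * hypCoeff a n) atTop (𝓝 (Real.sin (Real.pi * a) / Real.pi)) := by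
  have hsin := sin_pi_mul_pos ha
  refine (tendsto_add_atTop_iff_nat 1).1 ?_
  have h1 := (Real.GammaSeq_tendsto_Gamma a).mul (Real.GammaSeq_tendsto_Gamma (1 - a))
  rw [Real.Gamma_mul_Gamma_one_sub] at h1
  have h2 := (tendsto_natCast_div_add_atTop (1 : ℝ)).div h1 (div_pos Real.pi_pos hsin).ne'
  rw [one_div_div] at h2
  refine h2.congr' ?_
  filter_upwards [eventually_gt_atTop 0] with n hn
  have hn0 : (0 : ℝ) < n := Nat.cast_pos.2 hn
  have hprod : hypCoeff a (n + 1) = (∏ j ∈ Finset.range (n + 1), (a + j))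
      * (∏ j ∈ Finset.range (n + 1), (1 - a + j)) / ((n + 1).factorial : ℝ) ^ 2 := by
    rw [hypCoeff, Finset.prod_div_distrib, Finset.prod_mul_distrib, Finset.prod_pow,
      ← Finset.prod_range_add_one_eq_factorial]
    push_cast
    rfl
  have hp1 : 0 < ∏ j ∈ Finset.range (n + 1), (a + (j : ℝ)) :=
    Finset.prod_pos fun j _ => by have := ha.1; positivity
  have hp2 : 0 < ∏ j ∈ Finset.range (n + 1), (1 - a + (j : ℝ)) :=
    Finset.prod_pos fun j _ => by have : 0 < 1 - a := by linarith [ha.2]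
                                  positivity
  have hf : (0 : ℝ) < n.factorial := Nat.cast_pos.2 n.factorial_pos
  have hrp : (n : ℝ) ^ a * (n : ℝ) ^ (1 - a) = n := by
    rw [← Real.rpow_add hn0]
    simp
  have e : Real.GammaSeq a n * Real.GammaSeq (1 - a) n = ((n : ℝ) ^ a * (n : ℝ) ^ (1 - a))
      * (n.factorial : ℝ) ^ 2 / ((∏ j ∈ Finset.range (n + 1), (a + (j : ℝ)))
        * ∏ j ∈ Finset.range (n + 1), (1 - a + (j : ℝ))) := by
    rw [Real.GammaSeq, Real.GammaSeq]
    field_simp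
  simp only [Pi.div_apply]
  rw [e, hrp, hprod, Nat.factorial_succ]
  push_cast
  field_simp

/-- Gauss' value `a (1 - a) V(1) = sin (π a) / π`, as a left limit: the partial sums telescope. -/
lemma tendsto_hypV_one (ha : a ∈ Ioo (0 : ℝ) 1) :
    Tendsto (fun x => a * (1 - a) * hypV a x) (𝓝[<] 1)
      (𝓝 (Real.sin (Real.pi * a) / Real.pi)) := by
  have hsum : ∀ n : ℕ, ∑ i ∈ Finset.range n, a * (1 - a) * (hypCoeff a i / (i + 1))
      = n * hypCoeff a n := by
    intro n
    induction n with
    | zero => simp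
    | succ n ih =>
      rw [Finset.sum_range_succ, ih]
      push_cast
      rw [hypCoeff_succ]
      field_simp
      ring
  have h := Real.tendsto_tsum_powerSeries_nhdsWithin_lt
    (f := fun n : ℕ => a * (1 - a) * (hypCoeff a n / (n + 1)))
    ((tendsto_mul_hypCoeff ha).congr fun n => (hsum n).symm)
  refine h.congr fun x => ?_
  rw [hypV, ← tsum_mul_left]
  exact tsum_congr fun n => by ring

end

/-! ### Monotonicity and boundary behavior of the hypergeometric function -/

section

variable {a : ℝ}

/-- `(1 - x) F²`, the slope of `-log ∘ μ_a⁻¹`, has derivative `-F T`. -/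
lemma hasDerivAt_slopeFun (ha : a ∈ Ioo (0 : ℝ) 1) {x : ℝ} (hx : |x| < 1) :
    HasDerivAt (fun x => (1 - x) * hypF a x ^ 2) (-(hypF a x * hypT a x)) x := by
  have hx1 : 1 - x ≠ 0 := by linarith [le_abs_self x]
  refine (((hasDerivAt_id x).const_sub 1).mul ((hasDerivAt_hypF ha hx).pow 2)).congr_deriv ?_
  simp only [id, hypT, Pi.pow_apply]
  push_cast
  field_simp
  ring

lemma abs_lt_one_of_mem {x : ℝ} (hx : x ∈ Ico (0 : ℝ) 1) : |x| < 1 := by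
  rw [abs_of_nonneg hx.1]
  exact hx.2

lemma slopeFun_strictAntiOn (ha : a ∈ Ioo (0 : ℝ) 1) :
    StrictAntiOn (fun x => (1 - x) * hypF a x ^ 2) (Ico 0 1) :=
  strictAntiOn_of_hasDerivAt_neg (convex_Ico 0 1)
    (fun _ hx => hasDerivAt_slopeFun ha (abs_lt_one_of_mem hx))
    (fun _ hx => neg_neg_of_pos (mul_pos (hypF_pos ha hx) (hypT_pos ha hx)))

lemma one_sub_mul_hypF_strictAntiOn (ha : a ∈ Ioo (0 : ℝ) 1) :
    StrictAntiOn (fun x => (1 - x) * hypF a x) (Ico 0 1) := by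
  refine strictAntiOn_of_hasDerivAt_neg (f' := fun x => a * (1 - a) * hypV a x - hypF a x)
    (convex_Ico 0 1) (fun x hx => ?_) (fun x hx => ?_)
  · have hx1 : 1 - x ≠ 0 := by linarith [hx.2]
    refine (((hasDerivAt_id x).const_sub 1).mul
      (hasDerivAt_hypF ha (abs_lt_one_of_mem hx))).congr_deriv ?_
    simp only [id]
    field_simp
    ring
  · nlinarith [param_le a, hypV_le_hypF ha hx, one_le_hypV ha hx]

/-- `(x F(1 - x))² ≤ x`. -/
lemma tendsto_mul_hypF_one_sub (ha : a ∈ Ioo (0 : ℝ) 1) :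
    Tendsto (fun x => x * hypF a (1 - x)) (𝓝[>] 0) (𝓝 0) := by
  have hs : Tendsto Real.sqrt (𝓝[>] 0) (𝓝 0) := by
    have := (Real.continuous_sqrt.tendsto 0).mono_left (nhdsWithin_le_nhds (s := Ioi 0))
    rwa [Real.sqrt_zero] at this
  refine tendsto_of_tendsto_of_tendsto_of_le_of_le' tendsto_const_nhds hs ?_ ?_
  · filter_upwards [Ioo_mem_nhdsGT (zero_lt_one' ℝ)] with x hx
    exact (mul_pos hx.1 (hypF_pos ha ⟨by linarith [hx.2], by linarith [hx.1]⟩)).le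
  · filter_upwards [Ioo_mem_nhdsGT (zero_lt_one' ℝ)] with x hx
    have h1 := slopeFun_strictAntiOn ha (left_mem_Ico.2 one_pos)
      (show 1 - x ∈ Ico (0 : ℝ) 1 from ⟨by linarith [hx.2], by linarith [hx.1]⟩)
      (by linarith [hx.2])
    simp only [hypF_zero, sub_sub_cancel] at h1
    refine Real.le_sqrt_of_sq_le ?_
    nlinarith [hx.1]

/-- `F' ≥ a (1 - a) / (1 - x)`, so that `F` is unbounded. -/
lemma one_sub_log_le_hypF (ha : a ∈ Ioo (0 : ℝ) 1) {x : ℝ} (hx : x ∈ Ico (0 : ℝ) 1) :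
    1 - a * (1 - a) * Real.log (1 - x) ≤ hypF a x := by
  have hd : ∀ y ∈ Ico (0 : ℝ) 1, HasDerivAt (fun y => hypF a y + a * (1 - a) * Real.log (1 - y))
      (a * (1 - a) * (hypV a y - 1) / (1 - y)) y := by
    intro y hy
    have hy1 : 1 - y ≠ 0 := by linarith [hy.2]
    refine ((hasDerivAt_hypF ha (abs_lt_one_of_mem hy)).add
      ((((hasDerivAt_id y).const_sub 1).log hy1).const_mul (a * (1 - a)))).congr_deriv ?_
    simp only [id]
    field_simp
    ring
  have hm := monotoneOn_of_hasDerivWithinAt_nonneg (convex_Ico 0 1)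
    (fun y hy => (hd y hy).continuousAt.continuousWithinAt)
    (fun y hy => (hd y (interior_subset hy)).hasDerivWithinAt)
    (fun y hy => div_nonneg (mul_nonneg (param_pos ha).le
      (by linarith [one_le_hypV ha (interior_subset hy)])) (by linarith [(interior_subset hy).2]))
  have h := hm (left_mem_Ico.2 one_pos) hx hx.1
  simp only [hypF_zero, sub_zero, Real.log_one, mul_zero, add_zero] at h
  linarith

lemma tendsto_one_sub_nhdsGT : Tendsto (fun x : ℝ => 1 - x) (𝓝[>] 0) (𝓝[<] 1) := by
  refine tendsto_nhdsWithin_of_tendsto_nhds_of_eventually_within _ ?_ ?_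
  · have : Tendsto (fun x : ℝ => 1 - x) (𝓝 0) (𝓝 (1 - 0)) := tendsto_const_nhds.sub tendsto_id
    rw [sub_zero] at this
    exact this.mono_left nhdsWithin_le_nhds
  · filter_upwards [self_mem_nhdsWithin] with x hx
    exact sub_lt_self 1 (mem_Ioi.1 hx)

lemma tendsto_one_sub_nhdsLT : Tendsto (fun x : ℝ => 1 - x) (𝓝[<] 1) (𝓝[>] 0) := by
  refine tendsto_nhdsWithin_of_tendsto_nhds_of_eventually_within _ ?_ ?_
  · have : Tendsto (fun x : ℝ => 1 - x) (𝓝 1) (𝓝 (1 - 1)) := tendsto_const_nhds.sub tendsto_id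
    rw [sub_self] at this
    exact this.mono_left nhdsWithin_le_nhds
  · filter_upwards [self_mem_nhdsWithin] with x hx
    exact sub_pos.2 (mem_Iio.1 hx)

lemma tendsto_hypF_one (ha : a ∈ Ioo (0 : ℝ) 1) : Tendsto (hypF a) (𝓝[<] 1) atTop := by
  have h1 := Real.tendsto_log_nhdsGT_zero.comp tendsto_one_sub_nhdsLT
  have h2 := tendsto_atTop_add_const_left _ 1
    (tendsto_neg_atBot_atTop.comp (h1.const_mul_atBot (param_pos ha)))
  refine tendsto_atTop_mono' _ ?_ h2
  filter_upwards [Ioo_mem_nhdsLT (zero_lt_one' ℝ)] with x hx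
  have := one_sub_log_le_hypF ha ⟨hx.1.le, hx.2⟩
  simp only [Function.comp_apply]
  linarith

lemma one_sub_mem {x : ℝ} (hx : x ∈ Ioo (0 : ℝ) 1) : 1 - x ∈ Ioo (0 : ℝ) 1 :=
  ⟨by linarith [hx.2], by linarith [hx.1]⟩

lemma hasDerivAt_hypF_one_sub (ha : a ∈ Ioo (0 : ℝ) 1) {x : ℝ} (hx : x ∈ Ioo (0 : ℝ) 1) :
    HasDerivAt (fun x => hypF a (1 - x)) (-(a * (1 - a) * hypV a (1 - x) / x)) x := by
  have h := (hasDerivAt_hypF ha (abs_lt_one_of_mem (Ioo_subset_Ico_self (one_sub_mem hx)))).comp x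
    ((hasDerivAt_id x).const_sub 1)
  refine h.congr_deriv ?_
  rw [sub_sub_cancel]
  ring

/-- The generalized Legendre relation: `x (1 - x)` times the Wronskian of `F(x)` and `F(1 - x)` is
constant by the hypergeometric equation; its value is read off as `x → 0`. -/
lemma legendre_relation (ha : a ∈ Ioo (0 : ℝ) 1) {x : ℝ} (hx : x ∈ Ioo (0 : ℝ) 1) :
    a * (1 - a) * (x * hypF a (1 - x) * hypV a x + (1 - x) * hypV a (1 - x) * hypF a x)
      = Real.sin (Real.pi * a) / Real.pi := by
  set g := fun x => a * (1 - a) * (x * hypF a (1 - x) * hypV a x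
    + (1 - x) * hypV a (1 - x) * hypF a x) with hg
  have hd : ∀ y ∈ Ioo (0 : ℝ) 1, HasDerivAt g 0 y := by
    intro y hy
    have hy' := one_sub_mem hy
    have habs := abs_lt_one_of_mem (Ioo_subset_Ico_self hy)
    have habs' := abs_lt_one_of_mem (Ioo_subset_Ico_self hy')
    have h1 : HasDerivAt (fun x => hypV a (1 - x))
        (-((hypF a (1 - y) - hypV a (1 - y)) / (1 - y))) y := by
      have h := (hasDerivAt_hypV ha habs' hy'.1.ne').comp y ((hasDerivAt_id y).const_sub 1)
      exact h.congr_deriv (by ring)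
    have h2 := ((((hasDerivAt_id y).mul (hasDerivAt_hypF_one_sub ha hy)).mul
      (hasDerivAt_hypV ha habs hy.1.ne')).add ((((hasDerivAt_id y).const_sub 1).mul h1).mul
      (hasDerivAt_hypF ha habs))).const_mul (a * (1 - a))
    refine h2.congr_deriv ?_
    have := hy.1.ne'
    have := hy'.1.ne'
    simp only [id, Pi.mul_apply]
    field_simp
    ring
  have hconst : ∀ y ∈ Ioo (0 : ℝ) 1, g y = g x := fun y hy =>
    isOpen_Ioo.is_const_of_deriv_eq_zero isPreconnected_Ioo
      (fun z hz => (hd z hz).differentiableAt.differentiableWithinAt)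
      (fun z hz => (hd z hz).deriv) hy hx
  have hlim : Tendsto g (𝓝[>] 0) (𝓝 (Real.sin (Real.pi * a) / Real.pi)) := by
    have h0 : Tendsto (hypF a) (𝓝[>] 0) (𝓝 1) := by
      have := (hasDerivAt_hypF ha (x := 0) (by simp)).continuousAt.tendsto
      rw [hypF_zero] at this
      exact this.mono_left nhdsWithin_le_nhds
    have h1 := (continuousAt_hypV ha (x := 0) (by simp)).tendsto.mono_left
      (nhdsWithin_le_nhds (s := Ioi 0))
    have h2 := (tendsto_hypV_one ha).comp tendsto_one_sub_nhdsGT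
    have h3 := (tendsto_nhdsWithin_iff.1 tendsto_one_sub_nhdsGT).1
    have h4 := (((tendsto_mul_hypF_one_sub ha).mul h1).const_mul (a * (1 - a))).add
      ((h3.mul h2).mul h0)
    simp only [zero_mul, mul_zero, zero_add, one_mul, mul_one] at h4
    refine h4.congr fun y => ?_
    simp only [Function.comp_apply, hg]
    ring
  refine tendsto_nhds_unique (tendsto_const_nhds.congr' ?_) hlim
  filter_upwards [Ioo_mem_nhdsGT (zero_lt_one' ℝ)] with y hy
  exact (hconst y hy).symm

/-! ### The generalized Grötzsch ring function in the variable `x = r²` -/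

/-- `μ_a` as a function of `x = r²`. -/
noncomputable def grotzschSq (a x : ℝ) : ℝ :=
  Real.pi / (2 * Real.sin (Real.pi * a)) * (hypF a (1 - x) / hypF a x)

lemma genEllipticK_eq (a r : ℝ) : genEllipticK a r = Real.pi / 2 * hypF a (r ^ 2) := by
  rw [genEllipticK, ordinaryHypergeometric_eq_hypF]

lemma compModulus_sq {r : ℝ} (hr : r ∈ Ioo (0 : ℝ) 1) : compModulus r ^ 2 = 1 - r ^ 2 := by
  rw [compModulus, Real.sq_sqrt]
  nlinarith [hr.1, hr.2]

lemma sq_mem {r : ℝ} (hr : r ∈ Ioo (0 : ℝ) 1) : r ^ 2 ∈ Ioo (0 : ℝ) 1 :=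
  ⟨pow_pos hr.1 2, pow_lt_one₀ hr.1.le hr.2 two_ne_zero⟩

lemma genGrotzsch_eq {r : ℝ} (hr : r ∈ Ioo (0 : ℝ) 1) :
    genGrotzsch a r = grotzschSq a (r ^ 2) := by
  rw [genGrotzsch, grotzschSq, genEllipticK_eq, genEllipticK_eq, compModulus_sq hr,
    mul_div_mul_left _ _ (by positivity)]

lemma genHubnerM_eq (ha : a ∈ Ioo (0 : ℝ) 1) {r : ℝ} (hr : r ∈ Ioo (0 : ℝ) 1) :
    genHubnerM a r = genGrotzsch a r * ((1 - r ^ 2) * hypF a (r ^ 2) ^ 2) := by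
  have h1 := (sin_pi_mul_pos ha).ne'
  have h2 := Real.pi_pos.ne'
  have h3 := (hypF_pos ha (Ioo_subset_Ico_self (sq_mem hr))).ne'
  rw [genGrotzsch_eq hr, grotzschSq, genHubnerM, genEllipticK_eq, genEllipticK_eq,
    compModulus_sq hr]
  field_simp

lemma hasDerivAt_grotzschSq (ha : a ∈ Ioo (0 : ℝ) 1) {x : ℝ} (hx : x ∈ Ioo (0 : ℝ) 1) :
    HasDerivAt (grotzschSq a) (-(2 * x * ((1 - x) * hypF a x ^ 2))⁻¹) x := by
  have hF := (hypF_pos ha (Ioo_subset_Ico_self hx)).ne'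
  have hs := (sin_pi_mul_pos ha).ne'
  have hpi := Real.pi_pos.ne'
  have hx0 := hx.1.ne'
  have hx1 := (one_sub_mem hx).1.ne'
  have h := ((hasDerivAt_hypF_one_sub ha hx).div
    (hasDerivAt_hypF ha (abs_lt_one_of_mem (Ioo_subset_Ico_self hx))) hF).const_mul
    (Real.pi / (2 * Real.sin (Real.pi * a)))
  refine h.congr_deriv ?_
  have e : -(a * (1 - a) * hypV a (1 - x) / x) * hypF a x
      - hypF a (1 - x) * (a * (1 - a) * hypV a x / (1 - x))
      = -(Real.sin (Real.pi * a) / Real.pi) / (x * (1 - x)) := by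
    rw [← legendre_relation ha hx]
    field_simp
    ring
  rw [e]
  field_simp

lemma grotzschSq_pos (ha : a ∈ Ioo (0 : ℝ) 1) {x : ℝ} (hx : x ∈ Ioo (0 : ℝ) 1) :
    0 < grotzschSq a x := by
  have h1 := hypF_pos ha (Ioo_subset_Ico_self hx)
  have h2 := hypF_pos ha (Ioo_subset_Ico_self (one_sub_mem hx))
  have h3 := sin_pi_mul_pos ha
  rw [grotzschSq]
  positivity

lemma grotzschSq_strictAntiOn (ha : a ∈ Ioo (0 : ℝ) 1) :
    StrictAntiOn (grotzschSq a) (Ioo 0 1) := by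
  refine strictAntiOn_of_hasDerivAt_neg (convex_Ioo 0 1)
    (fun x hx => hasDerivAt_grotzschSq ha hx) (fun x hx => ?_)
  have h1 := hypF_pos ha (Ioo_subset_Ico_self hx)
  have h2 := hx.1
  have h3 := (one_sub_mem hx).1
  exact neg_neg_of_pos (by positivity)

lemma tendsto_grotzschSq_zero (ha : a ∈ Ioo (0 : ℝ) 1) :
    Tendsto (grotzschSq a) (𝓝[>] 0) atTop := by
  have h1 := (hasDerivAt_hypF ha (x := 0) (by simp)).continuousAt.tendsto.mono_left
    (nhdsWithin_le_nhds (s := Ioi 0))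
  rw [hypF_zero] at h1
  have h2 := ((tendsto_hypF_one ha).comp tendsto_one_sub_nhdsGT).atTop_mul_pos
    one_pos (by simpa using h1.inv₀ one_ne_zero)
  have h3 := h2.const_mul_atTop (div_pos Real.pi_pos (mul_pos two_pos (sin_pi_mul_pos ha)))
  exact h3.congr fun x => by simp only [grotzschSq, Function.comp_apply, div_eq_mul_inv]

lemma tendsto_grotzschSq_one (ha : a ∈ Ioo (0 : ℝ) 1) :
    Tendsto (grotzschSq a) (𝓝[<] 1) (𝓝 0) := by
  have h1 := (hasDerivAt_hypF ha (x := 0) (by simp)).continuousAt.tendsto.mono_left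
    (nhdsWithin_le_nhds (s := Ioi 0))
  have h2 := ((h1.comp tendsto_one_sub_nhdsLT).div_atTop (tendsto_hypF_one ha)).const_mul
    (Real.pi / (2 * Real.sin (Real.pi * a)))
  rw [mul_zero] at h2
  exact h2

lemma grotzschSq_surjOn (ha : a ∈ Ioo (0 : ℝ) 1) :
    SurjOn (grotzschSq a) (Ioo 0 1) (Ioi 0) := by
  intro v hv
  obtain ⟨x, hxv, hx⟩ := (((tendsto_grotzschSq_zero ha).eventually_gt_atTop v).and
    (Ioo_mem_nhdsGT (zero_lt_one' ℝ))).exists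
  obtain ⟨y, hyv, hy⟩ := (((tendsto_grotzschSq_one ha).eventually_lt_const hv).and
    (Ioo_mem_nhdsLT (zero_lt_one' ℝ))).exists
  exact isPreconnected_Ioo.intermediate_value hy hx
    (fun z hz => (hasDerivAt_grotzschSq ha hz).continuousAt.continuousWithinAt)
    ⟨hyv.le, hxv.le⟩

/-! ### The inverse modulus -/

/-- The inverse `μ_a⁻¹ : (0, ∞) → (0, 1)`. -/
noncomputable def invGrotzsch (a v : ℝ) : ℝ := Function.invFunOn (genGrotzsch a) (Ioo 0 1) v

lemma genGrotzsch_pos (ha : a ∈ Ioo (0 : ℝ) 1) {r : ℝ} (hr : r ∈ Ioo (0 : ℝ) 1) :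
    0 < genGrotzsch a r := by
  rw [genGrotzsch_eq hr]
  exact grotzschSq_pos ha (sq_mem hr)

lemma genGrotzsch_strictAntiOn (ha : a ∈ Ioo (0 : ℝ) 1) :
    StrictAntiOn (genGrotzsch a) (Ioo 0 1) := by
  intro r hr t ht hrt
  rw [genGrotzsch_eq hr, genGrotzsch_eq ht]
  exact grotzschSq_strictAntiOn ha (sq_mem hr) (sq_mem ht)
    (pow_lt_pow_left₀ hrt hr.1.le two_ne_zero)

lemma genGrotzsch_surjOn (ha : a ∈ Ioo (0 : ℝ) 1) :
    SurjOn (genGrotzsch a) (Ioo 0 1) (Ioi 0) := by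
  intro v hv
  obtain ⟨x, hx, rfl⟩ := grotzschSq_surjOn ha hv
  have hr : √x ∈ Ioo (0 : ℝ) 1 :=
    ⟨Real.sqrt_pos.2 hx.1, by rw [Real.sqrt_lt' one_pos, one_pow]; exact hx.2⟩
  exact ⟨√x, hr, by rw [genGrotzsch_eq hr, Real.sq_sqrt hx.1.le]⟩

lemma invGrotzsch_mem (ha : a ∈ Ioo (0 : ℝ) 1) {v : ℝ} (hv : 0 < v) :
    invGrotzsch a v ∈ Ioo (0 : ℝ) 1 := Function.invFunOn_mem (genGrotzsch_surjOn ha hv)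

lemma genGrotzsch_invGrotzsch (ha : a ∈ Ioo (0 : ℝ) 1) {v : ℝ} (hv : 0 < v) :
    genGrotzsch a (invGrotzsch a v) = v := Function.invFunOn_eq (genGrotzsch_surjOn ha hv)

lemma invGrotzsch_genGrotzsch (ha : a ∈ Ioo (0 : ℝ) 1) {r : ℝ} (hr : r ∈ Ioo (0 : ℝ) 1) :
    invGrotzsch a (genGrotzsch a r) = r :=
  (genGrotzsch_strictAntiOn ha).injOn.leftInvOn_invFunOn hr

lemma invGrotzsch_strictAntiOn (ha : a ∈ Ioo (0 : ℝ) 1) :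
    StrictAntiOn (invGrotzsch a) (Ioi 0) := by
  intro u hu v hv huv
  rwa [← (genGrotzsch_strictAntiOn ha).lt_iff_gt (invGrotzsch_mem ha hu) (invGrotzsch_mem ha hv),
    genGrotzsch_invGrotzsch ha hu, genGrotzsch_invGrotzsch ha hv]

lemma continuousAt_invGrotzsch (ha : a ∈ Ioo (0 : ℝ) 1) {v : ℝ} (hv : 0 < v) :
    ContinuousAt (invGrotzsch a) v := by
  have h : ContinuousAt (fun v => -invGrotzsch a v) v := by
    refine continuousAt_of_monotoneOn_of_image_mem_nhds (s := Ioi 0)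
      (fun x hx y hy hxy => neg_le_neg ((invGrotzsch_strictAntiOn ha).antitoneOn hx hy hxy))
      (Ioi_mem_nhds hv) ?_
    have hm := invGrotzsch_mem ha hv
    refine mem_of_superset (Ioo_mem_nhds (a := -1) (b := 0) (by linarith [hm.2])
      (by linarith [hm.1])) fun y hy => ?_
    have hy' : -y ∈ Ioo (0 : ℝ) 1 := ⟨by linarith [hy.2], by linarith [hy.1]⟩
    exact ⟨genGrotzsch a (-y), genGrotzsch_pos ha hy', by
      simp only [invGrotzsch_genGrotzsch ha hy', neg_neg]⟩
  exact h.neg.congr (Eventually.of_forall fun u => neg_neg _)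

lemma tendsto_invGrotzsch_zero (ha : a ∈ Ioo (0 : ℝ) 1) :
    Tendsto (invGrotzsch a) (𝓝[>] 0) (𝓝 1) := by
  refine tendsto_order.2 ⟨fun b hb => ?_, fun b hb => ?_⟩
  · have hr : max b (1 / 2) ∈ Ioo (0 : ℝ) 1 :=
      ⟨lt_max_of_lt_right (by norm_num), max_lt hb (by norm_num)⟩
    filter_upwards [Ioo_mem_nhdsGT (genGrotzsch_pos ha hr)] with v hv
    have := invGrotzsch_strictAntiOn ha hv.1 (genGrotzsch_pos ha hr) hv.2
    rw [invGrotzsch_genGrotzsch ha hr] at this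
    exact (le_max_left _ _).trans_lt this
  · filter_upwards [self_mem_nhdsWithin] with v hv
    exact (invGrotzsch_mem ha hv).2.trans hb

lemma tendsto_invGrotzsch_atTop (ha : a ∈ Ioo (0 : ℝ) 1) :
    Tendsto (invGrotzsch a) atTop (𝓝 0) := by
  refine tendsto_order.2 ⟨fun b hb => ?_, fun b hb => ?_⟩
  · filter_upwards [eventually_gt_atTop 0] with v hv
    exact hb.trans (invGrotzsch_mem ha hv).1
  · have hr : min b (1 / 2) ∈ Ioo (0 : ℝ) 1 :=
      ⟨lt_min hb (by norm_num), min_lt_of_right_lt (by norm_num)⟩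
    have h0 := genGrotzsch_pos ha hr
    filter_upwards [eventually_gt_atTop (genGrotzsch a (min b (1 / 2)))] with v hv
    have := invGrotzsch_strictAntiOn ha h0 (h0.trans hv) hv
    rw [invGrotzsch_genGrotzsch ha hr] at this
    exact this.trans_le (min_le_left _ _)

lemma hasDerivAt_invGrotzsch_sq (ha : a ∈ Ioo (0 : ℝ) 1) {v : ℝ} (hv : 0 < v) :
    HasDerivAt (fun v => invGrotzsch a v ^ 2) (-(2 * invGrotzsch a v ^ 2
      * ((1 - invGrotzsch a v ^ 2) * hypF a (invGrotzsch a v ^ 2) ^ 2))) v := by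
  have hx := sq_mem (invGrotzsch_mem ha hv)
  have h1 := hypF_pos ha (Ioo_subset_Ico_self hx)
  have h2 := hx.1
  have h3 := (one_sub_mem hx).1
  have h := HasDerivAt.of_local_left_inverse (f := grotzschSq a)
    (g := fun v => invGrotzsch a v ^ 2) ((continuousAt_invGrotzsch ha hv).pow 2)
    (hasDerivAt_grotzschSq ha hx) (neg_ne_zero.2 (by positivity)) ?_
  · rwa [inv_neg, inv_inv] at h
  · filter_upwards [Ioi_mem_nhds hv] with u hu
    rw [← genGrotzsch_eq (invGrotzsch_mem ha hu), genGrotzsch_invGrotzsch ha hu]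

lemma isLogInverseModulus (ha : a ∈ Ioo (0 : ℝ) 1) :
    IsLogInverseModulus (fun v => -Real.log (invGrotzsch a v))
      (fun v => (1 - invGrotzsch a v ^ 2) * hypF a (invGrotzsch a v ^ 2) ^ 2)
      (fun v => Real.pi / Real.sin (Real.pi * a) * (invGrotzsch a v ^ 2
        * hypF a (1 - invGrotzsch a v ^ 2) * hypT a (invGrotzsch a v ^ 2))) where
  pos v hv := by
    have := invGrotzsch_mem ha hv
    exact neg_pos.2 (Real.log_neg this.1 this.2)
  hasDerivAt v hv := by
    have hm := invGrotzsch_mem ha hv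
    have hx := (sq_mem hm).1.ne'
    have h := (((hasDerivAt_invGrotzsch_sq ha hv).log hx).const_mul (-(1 / 2)))
    refine (h.congr_of_eventuallyEq (Eventually.of_forall fun u => ?_)).congr_deriv ?_
    · simp only [Real.log_pow]
      push_cast
      ring
    · have := hm.1.ne'
      field_simp
  tendsto_zero := by
    have := (tendsto_invGrotzsch_zero ha).log one_ne_zero
    rw [Real.log_one] at this
    simpa using this.neg
  slope_pos v hv := by
    have hx := sq_mem (invGrotzsch_mem ha hv)
    exact mul_pos (one_sub_mem hx).1 (pow_pos (hypF_pos ha (Ioo_subset_Ico_self hx)) 2)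
  slope_lt_one v hv := by
    have hx := sq_mem (invGrotzsch_mem ha hv)
    have := slopeFun_strictAntiOn ha (left_mem_Ico.2 one_pos) (Ioo_subset_Ico_self hx) hx.1
    simpa [hypF_zero] using this
  slope_strictMonoOn u hu v hv huv := by
    have hmu := invGrotzsch_mem ha hu
    have hmv := invGrotzsch_mem ha hv
    exact slopeFun_strictAntiOn ha (Ioo_subset_Ico_self (sq_mem hmv))
      (Ioo_subset_Ico_self (sq_mem hmu))
      (pow_lt_pow_left₀ (invGrotzsch_strictAntiOn ha hu hv huv) hmv.1.le two_ne_zero)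
  hasDerivAt_slope v hv := by
    have hm := invGrotzsch_mem ha hv
    have hx := Ioo_subset_Ico_self (sq_mem hm)
    have h := (hasDerivAt_slopeFun ha (abs_lt_one_of_mem hx)).comp v
      (hasDerivAt_invGrotzsch_sq ha hv)
    refine h.congr_deriv ?_
    have hF := (hypF_pos ha hx).ne'
    have hF' := (hypF_pos ha (Ioo_subset_Ico_self (one_sub_mem (sq_mem hm)))).ne'
    have hs := (sin_pi_mul_pos ha).ne'
    have hpi := Real.pi_pos.ne'
    -- the factor `F(1 - x)` in `η` comes from the `v` in `v h' / h`
    have hv' : v = Real.pi / (2 * Real.sin (Real.pi * a))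
        * (hypF a (1 - invGrotzsch a v ^ 2) / hypF a (invGrotzsch a v ^ 2)) := by
      rw [← grotzschSq, ← genGrotzsch_eq hm, genGrotzsch_invGrotzsch ha hv]
    rw [eq_div_iff hv.ne']
    generalize invGrotzsch a v = s at *
    rw [hv']
    field_simp
  tendsto_slope := by
    have h1 := (hasDerivAt_slopeFun ha (x := 0) (by simp)).continuousAt.tendsto
    have h2 : Tendsto (fun v => invGrotzsch a v ^ 2) atTop (𝓝 0) := by
      simpa using (tendsto_invGrotzsch_atTop ha).pow 2
    have h3 := h1.comp h2
    rw [hypF_zero, one_pow, mul_one, sub_zero] at h3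
    exact h3
  logSlope_strictAntiOn u hu v hv huv := by
    have hmu := sq_mem (invGrotzsch_mem ha hu)
    have hmv := sq_mem (invGrotzsch_mem ha hv)
    have hlt : invGrotzsch a v ^ 2 < invGrotzsch a u ^ 2 :=
      pow_lt_pow_left₀ (invGrotzsch_strictAntiOn ha hu hv huv) (invGrotzsch_mem ha hv).1.le
        two_ne_zero
    have h1 := one_sub_mul_hypF_strictAntiOn ha (Ioo_subset_Ico_self (one_sub_mem hmu))
      (Ioo_subset_Ico_self (one_sub_mem hmv)) (by linarith)
    simp only [sub_sub_cancel] at h1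
    have h2 := monotoneOn_hypT ha (Ioo_subset_Ico_self hmv) (Ioo_subset_Ico_self hmu) hlt.le
    have h3 := hypT_pos ha (Ioo_subset_Ico_self hmv)
    have h4 : 0 < invGrotzsch a u ^ 2 * hypF a (1 - invGrotzsch a u ^ 2) :=
      mul_pos hmu.1 (hypF_pos ha (Ioo_subset_Ico_self (one_sub_mem hmu)))
    exact mul_lt_mul_of_pos_left (mul_lt_mul h1 h2 h3 h4.le)
      (div_pos Real.pi_pos (sin_pi_mul_pos ha))

/-! ### Distortion -/

lemma genHerschPfluger_one_div_eq (a w r : ℝ) :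
    genHerschPfluger a (1 / w) r = invGrotzsch a (w * genGrotzsch a r) := by
  rw [genHerschPfluger, invGrotzsch, div_div_eq_mul_div, div_one, mul_comm]

lemma genHerschPfluger_ratio_eq (ha : a ∈ Ioo (0 : ℝ) 1) {r t w : ℝ} (hr : r ∈ Ioo (0 : ℝ) 1)
    (ht : t ∈ Ioo (0 : ℝ) 1) (hrt : r * t ∈ Ioo (0 : ℝ) 1) (hw : 0 < w) :
    genHerschPfluger a (1 / w) r * genHerschPfluger a (1 / w) t
        / genHerschPfluger a (1 / w) (r * t)
      = Real.exp (-Real.log (invGrotzsch a (w * genGrotzsch a (r * t)))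
        - -Real.log (invGrotzsch a (w * genGrotzsch a r))
        - -Real.log (invGrotzsch a (w * genGrotzsch a t))) := by
  have h : ∀ s ∈ Ioo (0 : ℝ) 1, 0 < invGrotzsch a (w * genGrotzsch a s) := fun s hs =>
    (invGrotzsch_mem ha (mul_pos hw (genGrotzsch_pos ha hs))).1
  simp only [genHerschPfluger_one_div_eq]
  rw [Real.exp_sub, Real.exp_sub, Real.exp_neg, Real.exp_neg, Real.exp_neg, Real.exp_log (h r hr),
    Real.exp_log (h t ht), Real.exp_log (h _ hrt)]
  have := (h r hr).ne'
  have := (h t ht).ne'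
  have := (h _ hrt).ne'
  field_simp

end

theorem theorem3 (α β γ : ℝ → ℝ → ℝ → ℝ) :
    ∀ a ∈ Set.Ioc (0 : ℝ) (1 / 2), ∀ r ∈ Set.Ioo (0 : ℝ) 1, ∀ t ∈ Set.Ioo (0 : ℝ) 1,
      ((∀ K : ℝ, 1 < K →
          genHerschPfluger a K r * genHerschPfluger a K t / genHerschPfluger a K (r * t)
            < Real.exp (α a r t * (1 - 1 / K)))
        ↔ genHubnerM a r + genHubnerM a t - genHubnerM a (r * t) ≤ α a r t) ∧
      ((∀ K : ℝ, 1 < K →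
          Real.exp (γ a r t * (1 - K))
            < genHerschPfluger a (1 / K) r * genHerschPfluger a (1 / K) t
                / genHerschPfluger a (1 / K) (r * t) ∧
          genHerschPfluger a (1 / K) r * genHerschPfluger a (1 / K) t
                / genHerschPfluger a (1 / K) (r * t)
            < Real.exp (β a r t * (1 - K)))
        ↔ β a r t ≤ genHubnerM a r + genHubnerM a t - genHubnerM a (r * t) ∧
          genGrotzsch a r + genGrotzsch a t - genGrotzsch a (r * t) ≤ γ a r t) := by
  intro a ha' r hr t ht
  have ha : a ∈ Ioo (0 : ℝ) 1 := ⟨ha'.1, by linarith [ha'.2]⟩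
  have hrt : r * t ∈ Ioo (0 : ℝ) 1 :=
    ⟨mul_pos hr.1 ht.1, mul_lt_one_of_nonneg_of_lt_one_left hr.1.le hr.2 ht.2.le⟩
  have H := isLogInverseModulus ha
  have hA := genGrotzsch_pos ha hr
  have hB := genGrotzsch_pos ha ht
  have hC := genGrotzsch_pos ha hrt
  have hABC : -Real.log (invGrotzsch a (genGrotzsch a r))
      + -Real.log (invGrotzsch a (genGrotzsch a t))
      = -Real.log (invGrotzsch a (genGrotzsch a (r * t))) := by
    rw [invGrotzsch_genGrotzsch ha hr, invGrotzsch_genGrotzsch ha ht,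
      invGrotzsch_genGrotzsch ha hrt, Real.log_mul hr.1.ne' ht.1.ne']
    ring
  have hratio := fun w (hw : 0 < w) => genHerschPfluger_ratio_eq ha hr ht hrt hw
  have hlt := fun w => H.lt_tangent hA hB hC hABC (w := w)
  have hasy := fun w => H.asymptote_lt hA hB hC hABC (w := w)
  have hnα := H.tangent_le_of_left hA hB hC hABC (α := α a r t)
  have hnβ := H.le_tangent_of_right hA hB hC hABC (β := β a r t)
  have hnγ := H.asymptote_le hA hB hC (γ := γ a r t)
  simp only [invGrotzsch_genGrotzsch ha hr, invGrotzsch_genGrotzsch ha ht,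
    invGrotzsch_genGrotzsch ha hrt, ← genHubnerM_eq ha hr, ← genHubnerM_eq ha ht,
    ← genHubnerM_eq ha hrt] at hlt hnα hnβ
  refine ⟨⟨fun h => hnα fun w hw0 hw1 => ?_, fun h K hK => ?_⟩,
    ⟨fun h => ⟨hnβ fun w hw => ?_, hnγ fun w hw => ?_⟩, fun h K hK => ?_⟩⟩
  · have := h (1 / w) (by rwa [lt_div_iff₀ hw0, one_mul])
    rwa [hratio w hw0, one_div_one_div, Real.exp_lt_exp] at this
  · have hK0 : 0 < 1 / K := by positivity
    have hK1 : 1 / K < 1 := by rwa [div_lt_one (by positivity)]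
    have := hratio (1 / K) hK0
    rw [one_div_one_div] at this
    rw [this, Real.exp_lt_exp]
    exact (hlt _ hK0 hK1.ne).trans_le (mul_le_mul_of_nonneg_right h (by linarith))
  · have := (h w hw).2
    rwa [hratio w (by linarith), Real.exp_lt_exp] at this
  · have := (h w hw).1
    rwa [hratio w (by linarith), Real.exp_lt_exp] at this
  · rw [hratio K (by linarith), Real.exp_lt_exp, Real.exp_lt_exp]
    refine ⟨(mul_le_mul_of_nonpos_right h.2 (by linarith)).trans_lt (hasy K hK), ?_⟩
    exact (hlt K (by linarith) hK.ne').trans_le (mul_le_mul_of_nonpos_right h.1 (by linarith))
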